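/- All digraphs are finite, without loops and without multiple arcs (a pair of opposite arcs $xy$, $yx$ is allowed), and paths are directed. A digraph $D$ is *quasi-transitive* if for any three distinct vertices $x,y,z$ such that $xy$ and $yz$ are arcs of $D$, there is at least one arc between $x$ and $z$. It is *$m$-strong* if it has at least $m+1$ vertices and, after deleting any set of fewer than $m$ vertices, there is a path from $x$ to $y$ for any two distinct remaining vertices $x$ and $y$. It is *$k$-linked* if it has at least $2k$ vertices and for any $2k$ distinct vertices $x_1,\dots,x_k,y_1,\dots,y_k$ there exist pairwise vertex-disjoint paths $P_1,\dots,P_k$ such that $P_i$ is a path from $x_i$ to $y_i$ for each $i$. Let $\delta^+(D)$ denote the minimum out-degree of $D$. **Corollary.** Let $k\ge 1$ be an integer. Every $3k$-strong quasi-transitive digraph $D$ with $\delta^+(D)\ge 23k$ is $k$-linked. -/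

import Mathlib

namespace Digraph

/-- A digraph without loops. Since the arcs are given by a relation there are never multiple
arcs, so this says that the digraph is simple; opposite arcs `xy` and `yx` may both be present. -/
def IsLoopless {V : Type*} (D : Digraph V) : Prop :=
  ∀ v, ¬ D.Adj v v

/-- The out-degree of `v`: the number of vertices `w` such that `vw` is an arc. -/
noncomputable def outDegree {V : Type*} (D : Digraph V) (v : V) : ℕ :=
  {w | D.Adj v w}.ncard

/-- The minimum out-degree of a (finite, nonempty) digraph. -/
noncomputable def minOutDegree {V : Type*} (D : Digraph V) : ℕ :=
  ⨅ v, D.outDegree v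

/-- For any three vertices `x, y, z` such that `xy` and `yz` are arcs, there is at least one arc
between `x` and `z`. -/
def IsQuasiTransitive {V : Type*} (D : Digraph V) : Prop :=
  ∀ x y z, x ≠ y → y ≠ z → x ≠ z → D.Adj x y → D.Adj y z → D.Adj x z ∨ D.Adj z x

/-- `p` is the vertex sequence of a directed path from `x` to `y`: it starts at `x`, ends at `y`,
repeats no vertex, and any two consecutive vertices are joined by an arc in the direction of
traversal. -/
def IsDiPath {V : Type*} (D : Digraph V) (x y : V) (p : List V) : Prop :=
  p.head? = some x ∧ p.getLast? = some y ∧ p.Nodup ∧ p.IsChain D.Adj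

/-- A (finite) digraph is `m`-strong if it has at least `m + 1` vertices and, after deleting any
set `S` of fewer than `m` vertices, there is a path from `x` to `y` for any two distinct
remaining vertices `x` and `y`. -/
def IsStrong {V : Type*} (D : Digraph V) (m : ℕ) : Prop :=
  m + 1 ≤ Nat.card V ∧
    ∀ S : Finset V, S.card < m → ∀ x y, x ∉ S → y ∉ S → x ≠ y →
      ∃ p, D.IsDiPath x y p ∧ ∀ v ∈ p, v ∉ S

/-- A (finite) digraph is `k`-linked if it has at least `2k` vertices and, for any `2k` distinct
vertices `x₁, …, xₖ, y₁, …, yₖ`, there are pairwise vertex-disjoint paths `P₁, …, Pₖ` such that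
`Pᵢ` is a path from `xᵢ` to `yᵢ`. -/
def IsLinked {V : Type*} (D : Digraph V) (k : ℕ) : Prop :=
  2 * k ≤ Nat.card V ∧
    ∀ x y : Fin k → V, Function.Injective x → Function.Injective y → (∀ i j, x i ≠ y j) →
      ∃ P : Fin k → List V, (∀ i, D.IsDiPath (x i) (y i) (P i)) ∧
        ∀ i j, i ≠ j → List.Disjoint (P i) (P j)

end Digraph

open Finset Relation

/-! The problem is reduced to semicomplete digraphs. In a quasi-transitive digraph the components of
the nonadjacency graph are modules (`QuasiTrans.module`), and a strong one with at least two
vertices has more than one module (`QuasiTrans.exists_split`). Making all pairs inside modules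
adjacent (`completion`) keeps the connectivity (`QuasiTrans.completion_reach`) and loses only arcs
into the prescribed ends. Inside a module no end receives an arc from a non-end, so a nontrivial
path meeting a single end, its last vertex, finishes with an arc between modules. Its arcs inside
modules can then be bypassed, and the path pulls back to `D`
(`QuasiTrans.exists_simplePath_of_completion`).

In the semicomplete case (`exists_linking_of_semicomplete`), let `L` consist of `3k` vertices of
least strict out-degree off the starts. Menger's theorem (`exists_disjoint_paths`) links `L` to the
ends, and a linkage of minimal total length is taken. It remains to join each start to the first
vertex `l` of its path. One constructs many candidates `f`, each dominated by a vertex of `L` off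
the linkage. By minimality (`IsMinLinkage.length_le`), a candidate off the linkage has
out-neighbours only among the first three vertices of each linkage path, so however long the linkage
is, it hardly obstructs. Finally `exists_connector` reaches `l` from a free candidate in one or two
arcs: otherwise `l` strictly dominates all free candidates, and comparing its strict out-degree with
that of a candidate strictly dominating fewer than half of them gives that candidate too many
blocked out-neighbours. -/

/-! ### Paths and reachability. -/

/-- `p` is the vertex sequence of a path from `a` to `b` for the relation `r`. -/
def SimplePath {V : Type*} (r : V → V → Prop) (a b : V) (p : List V) : Prop :=
  p.head? = some a ∧ p.getLast? = some b ∧ p.Nodup ∧ p.IsChain r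

theorem SimplePath.mono {V : Type*} {r s : V → V → Prop} (h : ∀ u v, r u v → s u v) {a b : V}
    {p : List V} (hp : SimplePath r a b p) : SimplePath s a b p :=
  ⟨hp.1, hp.2.1, hp.2.2.1, hp.2.2.2.imp h⟩

theorem exists_simplePath_of_reflTransGen {V : Type*} {r : V → V → Prop} {a b : V}
    (h : ReflTransGen r a b) : ∃ p, SimplePath r a b p := by
  induction h using ReflTransGen.head_induction_on with
  | refl => exact ⟨[b], by simp [SimplePath]⟩
  | @head a c hac hcb ih =>
    obtain ⟨p, hh, hl, hn, hc⟩ := ih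
    by_cases ha : a ∈ p
    · obtain ⟨s, t, rfl⟩ := List.mem_iff_append.1 ha
      refine ⟨a :: t, rfl, ?_, (List.nodup_append.1 hn).2.1, (List.isChain_append.1 hc).2.1⟩
      simpa [List.getLast?_append] using hl
    · cases p with
      | nil => simp at hh
      | cons d p =>
        obtain rfl : d = c := by simpa using hh
        exact ⟨a :: d :: p, rfl, by simpa using hl, List.nodup_cons.2 ⟨ha, hn⟩,
          List.isChain_cons_cons.2 ⟨hac, hc⟩⟩

theorem List.IsChain.reflTransGen_of_mem {V : Type*} {r : V → V → Prop} {b v : V} {p : List V}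
    (hc : p.IsChain r) (hl : p.getLast? = some b) (hv : v ∈ p) : ReflTransGen r v b := by
  induction p generalizing v with
  | nil => simp at hv
  | cons d p ih =>
    cases p with
    | nil =>
      obtain rfl : v = d := by simpa using hv
      obtain rfl : v = b := by simpa using hl
      exact .refl
    | cons e p =>
      rw [List.isChain_cons_cons] at hc
      have hl' : (e :: p).getLast? = some b := by simpa using hl
      rcases List.mem_cons.1 hv with rfl | hv
      · exact .head hc.1 (ih hc.2 hl' (by simp))
      · exact ih hc.2 hl' hv

theorem SimplePath.reflTransGen_of_mem {V : Type*} {r : V → V → Prop} {a b v : V} {p : List V}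
    (hp : SimplePath r a b p) (hv : v ∈ p) : ReflTransGen r v b :=
  hp.2.2.2.reflTransGen_of_mem hp.2.1 hv

theorem SimplePath.reflTransGen {V : Type*} {r : V → V → Prop} {a b : V} {p : List V}
    (hp : SimplePath r a b p) : ReflTransGen r a b :=
  hp.reflTransGen_of_mem (List.mem_of_mem_head? hp.1)

theorem SimplePath.forall_mem {V : Type*} {r : V → V → Prop} {P : V → Prop}
    (h : ∀ u v, r u v → P u) {a b : V} {p : List V} (hp : SimplePath r a b p) (hb : P b) :
    ∀ v ∈ p, P v := by
  intro v hv
  rcases (hp.reflTransGen_of_mem hv).cases_head with rfl | ⟨c, hc, -⟩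
  exacts [hb, h _ _ hc]

/-- A path stepping out of a set contains an arc leaving that set. -/
theorem Relation.ReflTransGen.exists_step {V : Type*} {r : V → V → Prop} {P : V → Prop} {a b : V}
    (h : ReflTransGen r a b) (ha : ¬ P a) (hb : P b) : ∃ u v, r u v ∧ ¬ P u ∧ P v := by
  induction h with
  | refl => exact absurd hb ha
  | @tail c d _ hcd ih =>
    by_cases hc : P c
    · exact ih hc
    · exact ⟨c, d, hcd, hc, hb⟩

/-! ### Menger's theorem, derived from Hall's theorem. -/

/-- **Menger's theorem**, vertex version for sets: if no set with fewer vertices than `Y` separates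
`Y` from `A`, then there are disjoint paths from `A` ending in the different vertices of `Y`. -/
theorem exists_disjoint_paths {V : Type*} [Fintype V] [DecidableEq V] (r : V → V → Prop)
    (A Y : Finset V)
    (h : ∀ C : Finset V, C.card < Y.card → ∃ a ∈ A, ∃ y ∈ Y, a ∉ C ∧ y ∉ C ∧
      ReflTransGen (fun u v => r u v ∧ u ∉ C ∧ v ∉ C) a y) :
    ∃ P : V → List V, (∀ y ∈ Y, ∃ a ∈ A, SimplePath r a y (P y)) ∧
      ∀ y ∈ Y, ∀ y' ∈ Y, y ≠ y' → List.Disjoint (P y) (P y') := by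
  classical
  -- Hall's theorem assigns to the vertices off `A` distinct predecessors outside `Y`; a vertex
  -- assigned to itself is unused.
  obtain ⟨φ, hinj, hφ⟩ := (Finset.all_card_le_biUnion_card_iff_exists_injective
    (fun v : {v // v ∉ A} => (insert v.1 (univ.filter (r · v.1))) \ Y)).1 (by
      intro s
      by_contra hlt
      push Not at hlt
      set N := s.biUnion (fun v : {v // v ∉ A} => (insert v.1 (univ.filter (r · v.1))) \ Y) with hN
      set S := s.image Subtype.val with hS
      have hSc : S.card = s.card := card_image_of_injective _ Subtype.val_injective
      have hSN : S \ Y ⊆ N := by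
        intro v hv
        simp only [hS, mem_sdiff, mem_image] at hv
        obtain ⟨⟨w, hw, rfl⟩, hy⟩ := hv
        simp only [hN, mem_biUnion, mem_sdiff, mem_insert]
        exact ⟨w, hw, Or.inl rfl, hy⟩
      have hNY : ∀ v ∈ N, v ∉ Y := by
        intro v hv
        simp only [hN, mem_biUnion, mem_sdiff] at hv
        obtain ⟨_, _, _, h⟩ := hv
        exact h
      have h1 : (N ∩ S).card = (S \ Y).card := by
        congr 1
        ext v
        simp only [mem_inter, mem_sdiff]
        exact ⟨fun hv => ⟨hv.2, hNY v hv.1⟩, fun hv => ⟨hSN (mem_sdiff.2 hv), hv.1⟩⟩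
      have h2 := card_sdiff_add_card_inter N S
      have h3 := card_sdiff_add_card_inter S Y
      have h4 := card_sdiff_add_card_inter Y S
      rw [inter_comm Y S] at h4
      -- If `S` violates Hall's condition, then `N \ S` has `|N| - |S \ Y| < |S ∩ Y|` elements, so
      -- this separator is smaller than `Y`.
      have hC : ((N \ S) ∪ (Y \ S)).card < Y.card := by
        have := card_union_le (N \ S) (Y \ S)
        omega
      obtain ⟨a, ha, y, hy, haC, hyC, hr⟩ := h _ hC
      have hyS : y ∈ S := by
        by_contra hyS
        exact hyC (mem_union_right _ (mem_sdiff.2 ⟨hy, hyS⟩))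
      have haS : a ∉ S := by
        intro haS
        simp only [hS, mem_image] at haS
        obtain ⟨w, -, rfl⟩ := haS
        exact w.2 ha
      obtain ⟨u, v, ⟨huv, huC, -⟩, hu, hv⟩ := hr.exists_step (P := (· ∈ S)) haS hyS
      by_cases huY : u ∈ Y
      · exact huC (mem_union_right _ (mem_sdiff.2 ⟨huY, hu⟩))
      · refine huC (mem_union_left _ (mem_sdiff.2 ⟨?_, hu⟩))
        simp only [hS, mem_image] at hv
        obtain ⟨w, hw, rfl⟩ := hv
        simp only [hN, mem_biUnion, mem_sdiff, mem_insert, mem_filter, mem_univ, true_and]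
        exact ⟨w, hw, Or.inr huv, huY⟩)
  let ρ : V → V → Prop := fun u v => ∃ hv : v ∉ A, φ ⟨v, hv⟩ = u ∧ u ≠ v
  have hρr : ∀ u v, ρ u v → r u v := by
    rintro u v ⟨hv, rfl, hne⟩
    have := hφ ⟨v, hv⟩
    simp only [mem_sdiff, mem_insert, mem_filter, mem_univ, true_and] at this
    exact this.1.resolve_left hne
  have hρY : ∀ u v, ρ u v → u ∉ Y := by
    rintro u v ⟨hv, rfl, -⟩
    exact (mem_sdiff.1 (hφ ⟨v, hv⟩)).2
  have hρu : Relator.RightUnique ρ := by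
    rintro u v w ⟨hv, h1, -⟩ ⟨hw, h2, -⟩
    have := hinj (h1.trans h2.symm)
    simpa using this
  have key : ∀ y ∈ Y, ∃ a ∈ A, ReflTransGen ρ a y := by
    intro y hy
    by_contra hno
    push Not at hno
    -- If the ancestors of `y` miss `A`, the assignment maps this finite set injectively, hence
    -- onto, itself; but `y` is never a value.
    let R : Finset V := univ.filter fun u => ReflTransGen ρ u y
    have hRA : ∀ u ∈ R, u ∉ A := fun u hu ha => hno u ha (by simpa [R] using hu)
    let g : V → V := fun u => if hu : u ∈ A then u else φ ⟨u, hu⟩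
    have hg : ∀ u (hu : u ∉ A), g u = φ ⟨u, hu⟩ := fun u hu => by simp [g, hu]
    have hgY : ∀ u ∈ R, g u ∉ Y := fun u hu => by
      rw [hg u (hRA u hu)]
      exact (mem_sdiff.1 (hφ _)).2
    have hmaps : ∀ u ∈ R, g u ∈ R := by
      intro u hu
      have huA := hRA u hu
      have hur : ReflTransGen ρ u y := by simpa [R] using hu
      have hne : g u ≠ u := by
        intro he
        rcases hur.cases_head with rfl | ⟨c, ⟨hc, h1, h2⟩, -⟩
        · exact hgY u hu (by rwa [he])
        · have : φ ⟨u, huA⟩ = φ ⟨c, hc⟩ := by rw [← hg u huA, he, h1]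
          exact h2 (by simpa using hinj this)
      have : ReflTransGen ρ (g u) y := .head ⟨huA, (hg u huA).symm, hne⟩ hur
      simpa [R] using this
    have hsurj : Set.SurjOn g R R := by
      refine Finset.surjOn_of_injOn_of_card_le g hmaps ?_ le_rfl
      intro u hu v hv huv
      have hu' := hRA u hu
      have hv' := hRA v hv
      have : φ ⟨u, hu'⟩ = φ ⟨v, hv'⟩ := by rw [← hg u hu', ← hg v hv', huv]
      simpa using hinj this
    obtain ⟨u, hu, huy⟩ := hsurj (show y ∈ (R : Set V) by simp [R, ReflTransGen.refl])
    exact hgY u hu (by rwa [huy])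
  have key2 : ∀ y : V, ∃ p : List V, y ∈ Y → ∃ a ∈ A, SimplePath ρ a y p := by
    intro y
    by_cases hy : y ∈ Y
    · obtain ⟨a, ha, har⟩ := key y hy
      obtain ⟨p, hp⟩ := exists_simplePath_of_reflTransGen har
      exact ⟨p, fun _ => ⟨a, ha, hp⟩⟩
    · exact ⟨[], fun h => absurd h hy⟩
  choose P hP using key2
  refine ⟨P, fun y hy => ?_, fun y hy y' hy' hne v hv hv' => hne ?_⟩
  · obtain ⟨a, ha, hp⟩ := hP y hy
    exact ⟨a, ha, hp.mono hρr⟩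
  · obtain ⟨_, _, hp⟩ := hP y hy
    obtain ⟨_, _, hp'⟩ := hP y' hy'
    -- Successors under `ρ` are unique and vertices of `Y` have none, so two paths sharing a vertex
    -- have the same end.
    have fin : ∀ y ∈ Y, ∀ y', ReflTransGen ρ y y' → y = y' := by
      intro y hy y' hr
      rcases hr.cases_head with h | ⟨c, hc, -⟩
      exacts [h, absurd hy (hρY _ _ hc)]
    rcases ReflTransGen.total_of_right_unique hρu (hp.reflTransGen_of_mem hv)
      (hp'.reflTransGen_of_mem hv') with h | h
    exacts [fin y hy y' h, (fin y' hy' y h).symm]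

/-! ### Linkages of minimal total length. -/

/-- `Q` is a family of disjoint paths from `A` to the different vertices `y i`. -/
def IsLinkage {V ι : Type*} (r : V → V → Prop) (A : Finset V) (y : ι → V) (Q : ι → List V) :
    Prop :=
  (∀ i, ∃ a ∈ A, SimplePath r a (y i) (Q i)) ∧ ∀ i j, i ≠ j → List.Disjoint (Q i) (Q j)

/-- A linkage of minimal total length. -/
def IsMinLinkage {V ι : Type*} [Fintype ι] (r : V → V → Prop) (A : Finset V) (y : ι → V)
    (Q : ι → List V) : Prop :=
  IsLinkage r A y Q ∧ ∀ Q', IsLinkage r A y Q' → ∑ i, (Q i).length ≤ ∑ i, (Q' i).length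

theorem IsLinkage.exists_min {V ι : Type*} [Fintype ι] {r : V → V → Prop} {A : Finset V}
    {y : ι → V} {Q : ι → List V} (h : IsLinkage r A y Q) : ∃ Q, IsMinLinkage r A y Q := by
  classical
  have hex : ∃ n, ∃ Q, IsLinkage r A y Q ∧ ∑ i, (Q i).length = n := ⟨_, Q, h, rfl⟩
  obtain ⟨Q₀, h₀, hn⟩ := Nat.find_spec hex
  exact ⟨Q₀, h₀, fun Q' hQ' => hn.trans_le (Nat.find_min' hex ⟨Q', hQ', rfl⟩)⟩

/-- In a linkage of minimal total length no path has a shortcut through vertices off the linkage. -/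
theorem IsMinLinkage.length_le {V ι : Type*} [Fintype ι] {r : V → V → Prop}
    {A : Finset V} {y : ι → V} {Q : ι → List V} (h : IsMinLinkage r A y Q) {j : ι}
    {p t s : List V} {q a : V} (hj : Q j = p ++ q :: t) (hs : (s ++ q :: t).IsChain r)
    (hnd : s.Nodup) (hd : ∀ i, List.Disjoint s (Q i)) (ha : a ∈ A)
    (hh : (s ++ q :: t).head? = some a) : p.length ≤ s.length := by
  classical
  have hsub : ∀ v ∈ q :: t, v ∈ Q j := fun v hv => by
    rw [hj]; exact List.mem_append_right _ hv
  obtain ⟨b, hb, hp⟩ := h.1.1 j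
  have hnj := hp.2.2.1
  have hlj := hp.2.1
  rw [hj] at hnj hlj
  have key := h.2 (Function.update Q j (s ++ q :: t)) ⟨fun i => ?_, fun i i' hne => ?_⟩
  · rw [← Finset.add_sum_erase _ _ (Finset.mem_univ j),
      ← Finset.add_sum_erase _ _ (Finset.mem_univ j)] at key
    have : ∑ i ∈ univ.erase j, (Function.update Q j (s ++ q :: t) i).length
        = ∑ i ∈ univ.erase j, (Q i).length :=
      Finset.sum_congr rfl fun i hi => by
        rw [Function.update_of_ne (Finset.ne_of_mem_erase hi)]
    rw [this, Function.update_self, hj] at key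
    simp only [List.length_append, List.length_cons] at key
    omega
  · by_cases hi : i = j
    · subst hi
      rw [Function.update_self]
      refine ⟨a, ha, hh, ?_, ?_, hs⟩
      · simpa [List.getLast?_append] using hlj
      · refine List.nodup_append'.2 ⟨hnd, (List.nodup_append'.1 hnj).2.1, fun v hv hv' => ?_⟩
        exact hd i hv (hsub v hv')
    · rw [Function.update_of_ne hi]
      exact h.1.1 i
  · by_cases hi : i = j
    · subst hi
      rw [Function.update_self, Function.update_of_ne (Ne.symm hne)]
      intro v hv hv'
      rcases List.mem_append.1 hv with hv | hv
      · exact hd i' hv hv'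
      · exact h.1.2 i i' hne (hsub v hv) hv'
    · rw [Function.update_of_ne hi]
      by_cases hi' : i' = j
      · subst hi'
        rw [Function.update_self]
        intro v hv hv'
        rcases List.mem_append.1 hv' with hv' | hv'
        · exact hd i hv' hv
        · exact h.1.2 i i' hne hv (hsub v hv')
      · rw [Function.update_of_ne hi']
        exact h.1.2 i i' hne

section MinLinkage

variable {V ι : Type*} [Fintype ι] {r : V → V → Prop} {A : Finset V} {y : ι → V}
  {Q : ι → List V}

/-- The vertices of `A` on a minimal linkage are first vertices of its paths. -/
theorem IsMinLinkage.mem_take_one (h : IsMinLinkage r A y Q) {j : ι} {q : V} (hq : q ∈ Q j)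
    (hA : q ∈ A) : q ∈ (Q j).take 1 := by
  obtain ⟨p, t, hj⟩ := List.mem_iff_append.1 hq
  obtain ⟨a, ha, hp⟩ := h.1.1 j
  have hc := hp.2.2.2
  rw [hj] at hc
  have := h.length_le (s := []) hj (by simpa using (List.isChain_append.1 hc).2.1) (by simp)
    (by simp) hA (by simp)
  obtain rfl : p = [] := by simpa using this
  simp [hj]

/-- The part of the path before `q` could be replaced by `l` alone, so it has at most one vertex.
The next lemma does the same with the two vertices `l`, `f`. -/
theorem IsMinLinkage.mem_take_two (h : IsMinLinkage r A y Q) {j : ι} {l q : V} (hq : q ∈ Q j)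
    (hA : l ∈ A) (hl : ∀ i, l ∉ Q i) (hlq : r l q) : q ∈ (Q j).take 2 := by
  obtain ⟨p, t, hj⟩ := List.mem_iff_append.1 hq
  obtain ⟨a, ha, hp⟩ := h.1.1 j
  have hc := hp.2.2.2
  rw [hj] at hc
  have := h.length_le (s := [l]) hj
    (List.isChain_cons_cons.2 ⟨hlq, (List.isChain_append.1 hc).2.1⟩) (by simp)
    (by simpa using hl) hA (by simp)
  rw [hj, List.take_append]
  have h2 : 2 - p.length = (1 - p.length) + 1 := by simp at this; omega
  rw [h2]
  simp

theorem IsMinLinkage.mem_take_three (h : IsMinLinkage r A y Q) {j : ι} {l f q : V}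
    (hq : q ∈ Q j) (hA : l ∈ A) (hl : ∀ i, l ∉ Q i) (hf : ∀ i, f ∉ Q i) (hne : l ≠ f)
    (hlf : r l f) (hfq : r f q) : q ∈ (Q j).take 3 := by
  obtain ⟨p, t, hj⟩ := List.mem_iff_append.1 hq
  obtain ⟨a, ha, hp⟩ := h.1.1 j
  have hc := hp.2.2.2
  rw [hj] at hc
  have := h.length_le (s := [l, f]) hj
    (List.isChain_cons_cons.2 ⟨hlf, List.isChain_cons_cons.2
      ⟨hfq, (List.isChain_append.1 hc).2.1⟩⟩) (by simpa using hne)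
    (fun i => by simpa [List.disjoint_left] using ⟨hl i, hf i⟩) hA (by simp)
  rw [hj, List.take_append]
  have h2 : 3 - p.length = (2 - p.length) + 1 := by simp at this; omega
  rw [h2]
  simp

end MinLinkage

/-! ### Counting and choice lemmas. -/

/-- Among the subsets of `s` with `n` elements there is one on which `f` is smallest. -/
theorem exists_subset_card_eq_forall_le {α : Type*} [DecidableEq α] (f : α → ℕ) (s : Finset α)
    (n : ℕ) (hn : n ≤ s.card) :
    ∃ t ⊆ s, t.card = n ∧ ∀ a ∈ t, ∀ b ∈ s, b ∉ t → f a ≤ f b := by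
  induction n with
  | zero => exact ⟨∅, by simp, by simp, by simp⟩
  | succ n ih =>
    obtain ⟨t, hts, htn, ht⟩ := ih (by omega)
    have hne : (s \ t).Nonempty := by
      rw [← card_pos, card_sdiff_of_subset hts]
      omega
    obtain ⟨b, hb, hmin⟩ := exists_min_image (s \ t) f hne
    rw [mem_sdiff] at hb
    refine ⟨insert b t, insert_subset hb.1 hts, by rw [card_insert_of_notMem hb.2, htn], ?_⟩
    intro a ha c hc hct
    rw [mem_insert, not_or] at hct
    rcases mem_insert.1 ha with rfl | ha
    · exact hmin c (mem_sdiff.2 ⟨hc, hct.2⟩)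
    · exact ht a ha c hc hct.2

/-- An asymmetric relation on a nonempty finite set has an element with at most half of the others
as successors. -/
theorem exists_two_mul_card_filter_lt {α : Type*} (s : α → α → Prop) [DecidableRel s]
    (hs : ∀ a b, s a b → ¬ s b a) (F : Finset α) (hF : F.Nonempty) :
    ∃ f ∈ F, 2 * (F.filter (s f)).card < F.card := by
  classical
  have hsum : ∑ f ∈ F, (F.filter (s f)).card = ∑ f ∈ F, (F.filter (s · f)).card :=
    sum_card_bipartiteAbove_eq_sum_card_bipartiteBelow s
  have hle : ∑ f ∈ F, ((F.filter (s f)).card + (F.filter (s · f)).card) < ∑ _f ∈ F, F.card := by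
    refine sum_lt_sum_of_nonempty hF fun f hf => ?_
    rw [← card_union_of_disjoint (disjoint_filter.2 fun a _ h1 => hs _ _ h1)]
    refine card_lt_card ⟨union_subset (filter_subset _ _) (filter_subset _ _), fun h => ?_⟩
    have := h hf
    simp only [mem_union, mem_filter] at this
    rcases this with h | h <;> exact hs _ _ h.2 h.2
  rw [sum_add_distrib, ← hsum, ← two_mul, mul_sum] at hle
  exact exists_lt_of_sum_lt hle

/-- Choosing distinct representatives of sets that have at least as many elements as there are
sets. -/
theorem exists_injective_mem_of_card_le {ι α : Type*} [Fintype ι] [DecidableEq α]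
    (t : ι → Finset α) (h : ∀ i, Fintype.card ι ≤ (t i).card) :
    ∃ f : ι → α, Function.Injective f ∧ ∀ i, f i ∈ t i := by
  refine (Finset.all_card_le_biUnion_card_iff_exists_injective t).1 fun s => ?_
  rcases s.eq_empty_or_nonempty with rfl | ⟨i, hi⟩
  · simp
  · exact (card_le_univ s).trans ((h i).trans (card_le_card (subset_biUnion_of_mem t hi)))

/-- Greedy choice of disjoint lists. -/
theorem exists_disjoint_lists {ι α : Type*} [Fintype ι] [DecidableEq α]
    (good : ι → List α → Prop) (c : ℕ)
    (h : ∀ i, ∀ T : Finset α, T.card ≤ c * (Fintype.card ι - 1) →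
      ∃ m, good i m ∧ m.length ≤ c ∧ ∀ v ∈ m, v ∉ T) :
    ∃ M : ι → List α, (∀ i, good i (M i)) ∧ ∀ i j, i ≠ j → List.Disjoint (M i) (M j) := by
  classical
  suffices H : ∀ s : Finset ι, ∃ M : ι → List α, (∀ i ∈ s, good i (M i) ∧ (M i).length ≤ c) ∧
      ∀ i ∈ s, ∀ j ∈ s, i ≠ j → List.Disjoint (M i) (M j) by
    obtain ⟨M, h1, h2⟩ := H univ
    exact ⟨M, fun i => (h1 i (mem_univ i)).1, fun i j => h2 i (mem_univ i) j (mem_univ j)⟩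
  intro s
  induction s using Finset.induction_on with
  | empty => exact ⟨fun _ => [], by simp, by simp⟩
  | insert a s ha ih =>
    obtain ⟨M, h1, h2⟩ := ih
    obtain ⟨m, hm, hmc, hmT⟩ := h a (s.biUnion fun i => (M i).toFinset) (by
      have hs : s.card ≤ Fintype.card ι - 1 := by
        have := card_le_univ (insert a s)
        rw [card_insert_of_notMem ha] at this
        omega
      refine card_biUnion_le.trans ?_
      refine (sum_le_card_nsmul s _ c fun i hi =>
        (List.toFinset_card_le _).trans (h1 i hi).2).trans ?_
      rw [smul_eq_mul, mul_comm]
      exact Nat.mul_le_mul_left c hs)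
    have hmM : ∀ i ∈ s, List.Disjoint m (M i) := fun i hi v hv hv' =>
      hmT v hv (mem_biUnion.2 ⟨i, hi, by simpa using hv'⟩)
    have hne : ∀ i ∈ s, i ≠ a := fun i hi h => ha (h ▸ hi)
    refine ⟨Function.update M a m, fun i hi => ?_, fun i hi j hj hij => ?_⟩
    · rcases mem_insert.1 hi with rfl | hi
      · simpa using ⟨hm, hmc⟩
      · rw [Function.update_of_ne (hne i hi)]
        exact h1 i hi
    · rcases mem_insert.1 hi with rfl | hi' <;> rcases mem_insert.1 hj with rfl | hj'
      · exact absurd rfl hij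
      · rw [Function.update_self, Function.update_of_ne (hne j hj')]
        exact hmM j hj'
      · rw [Function.update_self, Function.update_of_ne (hne i hi')]
        exact (hmM i hi').symm
      · rw [Function.update_of_ne (hne i hi'), Function.update_of_ne (hne j hj')]
        exact h2 i hi' j hj' hij

theorem card_biUnion_toFinset_le {ι α : Type*} [Fintype ι] [DecidableEq α] (Q : ι → List α)
    (c : ℕ) (h : ∀ i, (Q i).length ≤ c) :
    (univ.biUnion fun i => (Q i).toFinset).card ≤ Fintype.card ι * c := by
  refine card_biUnion_le.trans ((sum_le_card_nsmul _ _ c fun i _ =>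
    (List.toFinset_card_le _).trans (h i)).trans ?_)
  simp

/-! ### Linking in semicomplete digraphs. -/

/-- The successors of `v` in `U` that are not predecessors. -/
def strictOut {V : Type*} (r : V → V → Prop) [DecidableRel r] (U : Finset V) (v : V) : Finset V :=
  U.filter fun u => r v u ∧ ¬ r u v

/-- If the strict out-degree of `l` is at most that of all vertices of a large set, then `l` is
reached from that set in at most two steps while avoiding a set of blocked vertices. -/
theorem exists_connector {V : Type*} [DecidableEq V] (r : V → V → Prop) [DecidableRel r]
    (hsemi : ∀ u v, u ≠ v → r u v ∨ r v u)
    (U F B : Finset V) (l e : V) (hlF : l ∉ F) (hFU : F ⊆ U)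
    (hlow : ∀ f ∈ F, (strictOut r U l).card ≤ (strictOut r U f).card)
    (hne : (F \ B).Nonempty)
    (hB : ∀ f ∈ F \ B, 2 * (B.filter (r f)).card ≤ (F \ B).card)
    (he : ∀ f ∈ F, r e f) (hirr : ∀ v, ¬ r v v) :
    ∃ m : List V, m.length ≤ 2 ∧ (e :: (m ++ [l])).IsChain r ∧ m ≠ [] ∧ m.Nodup ∧
      ∀ v ∈ m, v ∈ U ∧ v ∉ B := by
  by_contra hno
  have hdirect : ∀ f ∈ F \ B, ¬ r f l := by
    intro f hf hfl
    rw [mem_sdiff] at hf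
    exact hno ⟨[f], by simp, by simp [he f hf.1, hfl], by simp, by simp,
      by simpa using ⟨hFU hf.1, hf.2⟩⟩
  have htwo : ∀ f ∈ F \ B, ∀ z ∈ U, r f z → r z l → z ∈ B := by
    intro f hf z hz hfz hzl
    by_contra hzB
    rw [mem_sdiff] at hf
    have hfz' : f ≠ z := fun h => hirr z (h ▸ hfz)
    refine hno ⟨[f, z], by simp, by simp [he f hf.1, hfz, hzl], by simp, by simpa using hfz', ?_⟩
    simpa using ⟨⟨hFU hf.1, hf.2⟩, hz, hzB⟩
  obtain ⟨f, hf, hfmin⟩ := exists_two_mul_card_filter_lt (fun a b => r a b ∧ ¬ r b a)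
    (fun a b h h' => h.2 h'.1) (F \ B) hne
  have hfF := (mem_sdiff.1 hf).1
  -- More than half of `F \ B` lies in `strictOut r U l \ strictOut r U f`. By `hlow` the opposite
  -- difference is at least as large, yet it is confined to out-neighbours of `f` in `B`.
  have h1 : F \ B ⊆ strictOut r U l := by
    intro g hg
    have hgF := (mem_sdiff.1 hg).1
    have hgl := hdirect g hg
    have : l ≠ g := fun h => hlF (h ▸ hgF)
    exact mem_filter.2 ⟨hFU hgF, (hsemi l g this).resolve_right hgl, hgl⟩
  have h2 : (F \ B) \ ((F \ B).filter fun b => r f b ∧ ¬ r b f) ⊆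
      strictOut r U l \ strictOut r U f := by
    intro g hg
    rw [mem_sdiff] at hg ⊢
    refine ⟨h1 hg.1, fun h => hg.2 (mem_filter.2 ⟨hg.1, (mem_filter.1 h).2⟩)⟩
  have h3 : strictOut r U f \ strictOut r U l ⊆ B.filter (r f) := by
    intro z hz
    rw [mem_sdiff] at hz
    obtain ⟨hzU, hfz, hzf⟩ := mem_filter.1 hz.1
    have hzl : l ≠ z := fun h => hdirect f hf (h ▸ hfz)
    refine mem_filter.2 ⟨htwo f hf z hzU hfz ?_, hfz⟩
    by_contra h
    exact hz.2 (mem_filter.2 ⟨hzU, (hsemi l z hzl).resolve_right h, h⟩)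
  have c2 := card_le_card h2
  have c3 := card_le_card h3
  rw [card_sdiff_of_subset (filter_subset _ _)] at c2
  have c4 := card_sdiff_add_card_inter (strictOut r U f) (strictOut r U l)
  have c5 := card_sdiff_add_card_inter (strictOut r U l) (strictOut r U f)
  rw [inter_comm] at c5
  have c6 := hlow f hfF
  have c7 := hB f hf
  omega

/-- The linkage into the ends `y i` and the connecting lists are glued to the initial parts. -/
theorem simplePath_append {V : Type*} {r : V → V → Prop} {x y l : V} {a m q : List V} {e : V}
    (ha : a.IsChain r) (hx : a.head? = some x) (hl : a.getLast? = some e) (han : a.Nodup)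
    (hm : (e :: (m ++ [l])).IsChain r) (hm0 : m ≠ []) (hmn : m.Nodup)
    (hq : SimplePath r l y q) (ham : List.Disjoint a m) (haq : List.Disjoint a q)
    (hmq : List.Disjoint m q) : SimplePath r x y (a ++ (m ++ q)) := by
  obtain ⟨hqh, hql, hqn, hqc⟩ := hq
  obtain ⟨f, m, rfl⟩ := List.exists_cons_of_ne_nil hm0
  rw [List.cons_append, List.isChain_cons_cons, ← List.cons_append, List.isChain_append] at hm
  refine ⟨by simp [hx], by rw [← List.append_assoc, List.getLast?_append, hql]; rfl, ?_, ?_⟩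
  · rw [List.nodup_append', List.nodup_append']
    exact ⟨han, ⟨hmn, hqn, hmq⟩, List.disjoint_append_right.2 ⟨ham, haq⟩⟩
  · rw [List.isChain_append, List.isChain_append]
    refine ⟨ha, ⟨hm.2.1, hqc, fun u hu v hv => ?_⟩, fun u hu v hv => ?_⟩
    · rw [hqh] at hv
      obtain rfl : l = v := by simpa using hv
      exact hm.2.2.2 u hu l (by simp)
    · rw [hl] at hu
      obtain rfl : e = u := by simpa using hu
      obtain rfl : f = v := by simpa using hv
      exact hm.1

/-- A semicomplete digraph that stays strong after the deletion of fewer than `3k` vertices and in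
which every vertex has at least `21k` out-neighbours besides the prescribed ends has disjoint paths
joining these ends. -/
theorem exists_linking_of_semicomplete {V : Type*} [Fintype V] (r : V → V → Prop)
    (hirr : ∀ v, ¬ r v v) (hsemi : ∀ u v, u ≠ v → r u v ∨ r v u) (k : ℕ) (hk : 1 ≤ k)
    (x y : Fin k → V) (hx : Function.Injective x) (hy : Function.Injective y)
    (hxy : ∀ i j, x i ≠ y j)
    (hconn : ∀ S : Finset V, S.card < 3 * k → ∀ a b, a ∉ S → b ∉ S →
      ReflTransGen (fun u v => r u v ∧ u ∉ S ∧ v ∉ S) a b)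
    (hdeg : ∀ v, 21 * k ≤ {u | r v u ∧ (∀ i, u ≠ x i) ∧ ∀ i, u ≠ y i}.ncard) :
    ∃ P : Fin k → List V, (∀ i, SimplePath r (x i) (y i) (P i)) ∧
      ∀ i j, i ≠ j → List.Disjoint (P i) (P j) := by
  classical
  set X := univ.image x with hX
  set Y := univ.image y with hY
  have hXc : X.card = k := by simp [hX, card_image_of_injective _ hx]
  have hYc : Y.card = k := by simp [hY, card_image_of_injective _ hy]
  set U := univ \ X with hU
  have hYU : ∀ i, y i ∈ U := fun i => by
    simp only [hU, hX, mem_sdiff, mem_univ, true_and, mem_image, not_exists]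
    exact fun j => hxy j i
  let O : V → Finset V := fun v => univ.filter fun u => r v u ∧ u ∉ X ∧ u ∉ Y
  have hO : ∀ v, 21 * k ≤ (O v).card := by
    intro v
    refine (hdeg v).trans_eq ?_
    rw [← Set.ncard_coe_finset]
    congr 1
    ext u
    simp [O, hX, hY, eq_comm]
  have hOU : ∀ v, O v ⊆ U := fun v u hu => by
    simp only [O, mem_filter] at hu
    simp [hU, hu.2.2.1]
  have hOr : ∀ v u, u ∈ O v → r v u := fun v u hu => (mem_filter.1 hu).2.1
  have hOY : ∀ v u, u ∈ O v → u ∉ Y := fun v u hu => (mem_filter.1 hu).2.2.2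
  obtain ⟨L, hLU, hLc, hlow⟩ := exists_subset_card_eq_forall_le
    (fun v => (strictOut r U v).card) U (3 * k) (by
      have := (hO (x ⟨0, hk⟩)).trans (card_le_card (hOU _))
      omega)
  -- A start with at least `k` out-neighbours of this kind can step into `L` in two arcs; for any
  -- other start, discarding these vertices costs fewer than `k` candidates.
  let C : Fin k → Finset V := fun i =>
    (O (x i)).filter fun w => w ∉ L ∧ 2 * k ≤ (L.filter (r w)).card
  let p : Fin k → Prop := fun i => k ≤ (C i).card
  have hp : Fintype.card {i // p i} ≤ k := by
    simpa using Fintype.card_subtype_le p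
  obtain ⟨w, hw, hwC⟩ := exists_injective_mem_of_card_le (fun i : {i // p i} => C i.1)
    (fun i => hp.trans i.2)
  have hwC' : ∀ i, w i ∈ O (x i.1) ∧ w i ∉ L ∧ 2 * k ≤ (L.filter (r (w i))).card :=
    fun i => mem_filter.1 (hwC i)
  set W := univ.image w with hW
  have hWc : W.card ≤ k := card_image_le.trans (by simpa using hp)
  have hWmem : ∀ v, v ∈ W ↔ ∃ i, w i = v := fun v => by simp [hW]
  set U' := U \ W with hU'
  have hLU' : L ⊆ U' := fun v hv => mem_sdiff.2 ⟨hLU hv, fun h => by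
    obtain ⟨i, rfl⟩ := (hWmem v).1 h
    exact (hwC' i).2.1 hv⟩
  have hYU' : ∀ i, y i ∈ U' := fun i => mem_sdiff.2 ⟨hYU i, fun h => by
    obtain ⟨j, hj⟩ := (hWmem _).1 h
    exact hOY _ _ (hwC' j).1 (hj ▸ mem_image_of_mem y (mem_univ i))⟩
  let r' : V → V → Prop := fun u v => r u v ∧ u ∈ U' ∧ v ∈ U'
  obtain ⟨P₀, hP₀, hP₀d⟩ := exists_disjoint_paths r' L Y (by
    intro D hD
    obtain ⟨a, ha⟩ : (L \ D).Nonempty := by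
      rw [← card_pos]
      have := le_card_sdiff D L
      omega
    obtain ⟨b, hb⟩ : (Y \ D).Nonempty := by
      rw [← card_pos]
      have := le_card_sdiff D Y
      omega
    rw [mem_sdiff] at ha hb
    have hbU' : b ∈ U' := by
      obtain ⟨i, -, rfl⟩ := mem_image.1 hb.1
      exact hYU' i
    have hS : ∀ v, v ∉ X ∪ W ∪ D ↔ v ∈ U' ∧ v ∉ D := fun v => by
      simp [hU', hU, and_assoc]
    refine ⟨a, ha.1, b, hb.1, ha.2, hb.2, ReflTransGen.mono ?_ _ _
      (hconn (X ∪ W ∪ D) ?_ a b ((hS a).2 ⟨hLU' ha.1, ha.2⟩) ((hS b).2 ⟨hbU', hb.2⟩))⟩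
    · intro u v huv
      simp only [hS] at huv
      exact ⟨⟨huv.1, huv.2.1.1, huv.2.2.1⟩, huv.2.1.2, huv.2.2.2⟩
    -- The connectivity `3k` is spent here: at most `k` vertices each for `X` and `W`, and fewer
    -- than `k` for `D`.
    · have h1 := card_union_le (X ∪ W) D
      have h2 := card_union_le X W
      omega)
  have hlink : IsLinkage r' L y fun i => P₀ (y i) :=
    ⟨fun i => hP₀ _ (mem_image_of_mem y (mem_univ i)), fun i j hij =>
      hP₀d _ (mem_image_of_mem y (mem_univ i)) _ (mem_image_of_mem y (mem_univ j)) (hy.ne hij)⟩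
  obtain ⟨Q, hQ⟩ := hlink.exists_min
  set VQ := univ.biUnion fun i => (Q i).toFinset with hVQ
  have hVQmem : ∀ v, v ∈ VQ ↔ ∃ i, v ∈ Q i := fun v => by simp [hVQ]
  have hVQ' : ∀ v, v ∉ VQ → ∀ i, v ∉ Q i := fun v hv i hi => hv ((hVQmem v).2 ⟨i, hi⟩)
  have hQU' : ∀ i, ∀ v ∈ Q i, v ∈ U' := fun i => by
    obtain ⟨a, -, ha⟩ := hQ.1.1 i
    exact ha.forall_mem (fun u v h => h.2.1) (hYU' i)
  choose l hlL hlQ using hQ.1.1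
  have hlmem : ∀ i, l i ∈ Q i := fun i => List.mem_of_mem_head? (hlQ i).1
  have hLQ : (L ∩ VQ).card ≤ k := by
    have h1 := card_biUnion_toFinset_le (fun i => (Q i).take 1) 1 (fun i => by simp)
    refine (card_le_card fun v hv => ?_).trans (h1.trans (by simp))
    obtain ⟨hvL, hvQ⟩ := mem_inter.1 hv
    obtain ⟨i, hi⟩ := (hVQmem v).1 hvQ
    exact mem_biUnion.2 ⟨i, mem_univ i, by simpa using hQ.mem_take_one hi hvL⟩
  have hsub : ∀ A ⊆ L, A.card ≤ (A \ VQ).card + k := fun A hA => by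
    have h1 := card_sdiff_add_card_inter A VQ
    have h2 := card_le_card (inter_subset_inter_right (u := VQ) hA)
    omega
  -- Of the at least `2k` out-neighbours of `w i` in `L`, at most `k` lie on the linkage, so at
  -- least `k` remain to choose from.
  obtain ⟨h, hh, hhmem⟩ := exists_injective_mem_of_card_le
    (fun i : {i // p i} => L.filter (r (w i)) \ VQ) (fun i => by
      have h1 := hsub _ (filter_subset (r (w i)) L)
      have h2 := (hwC' i).2.2
      omega)
  have hhmem' : ∀ i, h i ∈ L ∧ r (w i) (h i) ∧ h i ∉ VQ := fun i => by
    have := hhmem i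
    rw [mem_sdiff, mem_filter] at this
    exact ⟨this.1.1, this.1.2, this.2⟩
  set H := univ.image h with hH
  have hHc : H.card ≤ k := card_image_le.trans (by simpa using hp)
  have hHmem : ∀ v, v ∈ H ↔ ∃ i, h i = v := fun v => by simp [hH]
  -- the initial part of each path and the choices for the next vertex
  have hpre : ∀ i, ∃ (a : List V) (e : V) (F : Finset V), a.IsChain r ∧ a.head? = some (x i) ∧
      a.getLast? = some e ∧ a.Nodup ∧
      (∀ v ∈ a, v = x i ∨ ∃ hi : p i, v = w ⟨i, hi⟩ ∨ v = h ⟨i, hi⟩) ∧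
      (∀ f ∈ F, r e f) ∧ F ⊆ U' ∧ (∀ f ∈ F, f ∉ L) ∧ 17 * k ≤ F.card ∧
      ∀ f ∈ F, ∃ g ∈ L, g ∉ VQ ∧ r g f := by
    intro i
    by_cases hi : p i
    · refine ⟨[x i, w ⟨i, hi⟩, h ⟨i, hi⟩], h ⟨i, hi⟩, O (h ⟨i, hi⟩) \ (L ∪ W), ?_, rfl, rfl, ?_, ?_,
        ?_, ?_, ?_, ?_, ?_⟩
      · simp [(hhmem' ⟨i, hi⟩).2.1, hOr _ _ (hwC' ⟨i, hi⟩).1]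
      · have hXU : ∀ v ∈ U, x i ≠ v := by
          rintro v hv rfl
          simp [hU, hX] at hv
        have h1 := hXU _ (hOU _ (hwC' ⟨i, hi⟩).1)
        have h2 := hXU _ (hLU (hhmem' ⟨i, hi⟩).1)
        have h3 : w ⟨i, hi⟩ ≠ h ⟨i, hi⟩ := fun he =>
          (hwC' ⟨i, hi⟩).2.1 (he ▸ (hhmem' ⟨i, hi⟩).1)
        simp [h1, h2, h3]
      · intro v hv
        simp only [List.mem_cons, List.not_mem_nil, or_false] at hv
        rcases hv with hv | hv
        exacts [Or.inl hv, Or.inr ⟨hi, hv⟩]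
      · exact fun f hf => hOr _ _ (mem_sdiff.1 hf).1
      · intro f hf
        rw [mem_sdiff, mem_union, not_or] at hf
        exact mem_sdiff.2 ⟨hOU _ hf.1, hf.2.2⟩
      · intro f hf
        rw [mem_sdiff, mem_union, not_or] at hf
        exact hf.2.1
      · have h1 := le_card_sdiff (L ∪ W) (O (h ⟨i, hi⟩))
        have h2 := card_union_le L W
        have h3 := hO (h ⟨i, hi⟩)
        omega
      · exact fun f hf => ⟨h ⟨i, hi⟩, (hhmem' _).1, (hhmem' _).2.2, hOr _ _ (mem_sdiff.1 hf).1⟩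
    · have hFmem : ∀ f, f ∈ (O (x i) \ L) \ C i ↔
          f ∈ O (x i) ∧ f ∉ L ∧ (L.filter (r f)).card < 2 * k := by
        intro f
        simp only [C, mem_sdiff, mem_filter, not_and, not_le]
        exact ⟨fun ⟨⟨h1, h2⟩, h3⟩ => ⟨h1, h2, h3 h1 h2⟩,
          fun ⟨h1, h2, h3⟩ => ⟨⟨h1, h2⟩, fun _ _ => h3⟩⟩
      refine ⟨[x i], x i, (O (x i) \ L) \ C i, by simp, rfl, rfl, by simp, by simp, ?_, ?_, ?_, ?_,
        ?_⟩
      · exact fun f hf => hOr _ _ ((hFmem f).1 hf).1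
      · intro f hf
        have hf' := (hFmem f).1 hf
        refine mem_sdiff.2 ⟨hOU _ hf'.1, fun hfW => ?_⟩
        obtain ⟨j, rfl⟩ := (hWmem f).1 hfW
        exact absurd (hwC' j).2.2 (not_le.2 hf'.2.2)
      · exact fun f hf => ((hFmem f).1 hf).2.1
      · have h1 := le_card_sdiff (C i) (O (x i) \ L)
        have h2 := le_card_sdiff L (O (x i))
        have h3 := hO (x i)
        have h4 : (C i).card < k := not_le.1 hi
        omega
      · intro f hf
        have hf' := (hFmem f).1 hf
        have h1 := hsub L subset_rfl
        -- At least `2k` vertices of `L` are off the linkage and `f` dominates fewer than `2k`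
        -- vertices of `L`; one not dominated by `f` must dominate it.
        obtain ⟨g, hg⟩ : ((L \ VQ) \ L.filter (r f)).Nonempty := by
          rw [← card_pos]
          have := le_card_sdiff (L.filter (r f)) (L \ VQ)
          omega
        simp only [mem_sdiff, mem_filter, not_and] at hg
        have hne : g ≠ f := fun he => hf'.2.1 (he ▸ hg.1.1)
        exact ⟨g, hg.1.1, hg.1.2, (hsemi g f hne).resolve_right (hg.2 hg.1.1)⟩
  choose a e F hac hah hal han hamem heF hFU' hFL hFc hFg using hpre
  have hU'U : U' ⊆ U := sdiff_subset
  set B₀ := VQ ∪ (W ∪ H) with hB₀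
  obtain ⟨M, hM, hMd⟩ := exists_disjoint_lists (fun i m => (e i :: (m ++ [l i])).IsChain r ∧
      m ≠ [] ∧ m.Nodup ∧ ∀ v ∈ m, v ∈ U ∧ v ∉ B₀) 2 (by
    intro i T hT
    rw [Fintype.card_fin] at hT
    -- A candidate on the linkage is among the first two vertices of its path, and it is not the
    -- first because it lies outside `L`.
    have hFQ : (F i ∩ VQ).card ≤ k := by
      have h1 := card_biUnion_toFinset_le (fun j => (Q j).tail.take 1) 1 (fun j => by simp)
      refine (card_le_card fun f hf => ?_).trans (h1.trans (by simp))
      obtain ⟨hfF, hfQ⟩ := mem_inter.1 hf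
      obtain ⟨j, hj⟩ := (hVQmem f).1 hfQ
      obtain ⟨g, hgL, hgQ, hgf⟩ := hFg i f hfF
      have h2 := hQ.mem_take_two hj hgL (hVQ' g hgQ) ⟨hgf, hLU' hgL, hFU' i hfF⟩
      refine mem_biUnion.2 ⟨j, mem_univ j, ?_⟩
      have h3 := (hlQ j).1
      cases hq : Q j with
      | nil => simp [hq] at h3
      | cons c q =>
        rw [hq] at h2 h3
        obtain rfl : c = l j := by simpa using h3
        have h4 : f ≠ l j := fun he => hFL i f hfF (he ▸ hlL j)
        simpa [h4] using h2
    have hFB : F i ∩ (B₀ ∪ T) ⊆ (F i ∩ VQ) ∪ T := by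
      intro f hf
      obtain ⟨hfF, hfB⟩ := mem_inter.1 hf
      simp only [hB₀, mem_union] at hfB
      rcases hfB with (hfB | hfB | hfB) | hfB
      · exact mem_union_left _ (mem_inter.2 ⟨hfF, hfB⟩)
      · exact absurd hfB (mem_sdiff.1 (hFU' i hfF)).2
      · obtain ⟨j, rfl⟩ := (hHmem f).1 hfB
        exact absurd (hhmem' j).1 (hFL i _ hfF)
      · exact mem_union_right _ hfB
    have hFc' : 14 * k + 2 ≤ (F i \ (B₀ ∪ T)).card := by
      have h1 := card_sdiff_add_card_inter (F i) (B₀ ∪ T)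
      have h2 := card_le_card hFB
      have h3 := card_union_le (F i ∩ VQ) T
      have h4 := hFc i
      omega
    obtain ⟨m, hm2, hmc, hm0, hmn, hmB⟩ := exists_connector r hsemi U (F i) (B₀ ∪ T) (l i) (e i)
      (fun hl => hFL i _ hl (hlL i)) ((hFU' i).trans hU'U)
      (fun f hf => hlow _ (hlL i) f (hU'U (hFU' i hf)) (hFL i f hf))
      (by rw [← card_pos]; omega) (by
        intro f hf
        rw [mem_sdiff] at hf
        obtain ⟨g, hgL, hgQ, hgf⟩ := hFg i f hf.1
        have hfQ : f ∉ VQ := fun hq => hf.2 (by simp [hB₀, hq])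
        -- This bounds the blocked out-neighbours of `f` by `3k + 2k + 2(k - 1) = 7k - 2`, and twice
        -- that is below the `14k + 2` free candidates.
        have h1 : ((B₀ ∪ T).filter (r f)) ⊆
            (univ.biUnion fun j => ((Q j).take 3).toFinset) ∪ (W ∪ H ∪ T) := by
          intro q hq
          obtain ⟨hqB, hfq⟩ := mem_filter.1 hq
          simp only [hB₀, mem_union] at hqB ⊢
          rcases hqB with (hqB | hqB) | hqB
          · obtain ⟨j, hj⟩ := (hVQmem q).1 hqB
            left
            refine mem_biUnion.2 ⟨j, mem_univ j, ?_⟩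
            rw [List.mem_toFinset]
            exact hQ.mem_take_three hj hgL (hVQ' g hgQ) (hVQ' f hfQ)
              (fun he => hFL i f hf.1 (he ▸ hgL)) ⟨hgf, hLU' hgL, hFU' i hf.1⟩
              ⟨hfq, hFU' i hf.1, hQU' j q hj⟩
          · exact Or.inr (Or.inl hqB)
          · exact Or.inr (Or.inr hqB)
        have h2 := card_biUnion_toFinset_le (fun j => (Q j).take 3) 3 (fun j => by simp)
        rw [Fintype.card_fin] at h2
        have h3 := card_le_card h1
        have h4 := card_union_le (univ.biUnion fun j => ((Q j).take 3).toFinset) (W ∪ H ∪ T)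
        have h5 := card_union_le (W ∪ H) T
        have h6 := card_union_le W H
        omega) (heF i) hirr
    refine ⟨m, ⟨hmc, hm0, hmn, fun v hv => ?_⟩, hm2, fun v hv hvT => ?_⟩
    · exact ⟨(hmB v hv).1, fun hvB => (hmB v hv).2 (mem_union_left _ hvB)⟩
    · exact (hmB v hv).2 (mem_union_right _ hvT))
  have haVQ : ∀ i, ∀ v ∈ a i, v ∉ VQ := by
    intro i v hv hvQ
    obtain ⟨j, hj⟩ := (hVQmem v).1 hvQ
    have hvU' := mem_sdiff.1 (hQU' j v hj)
    rcases hamem i v hv with rfl | ⟨hi, rfl | rfl⟩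
    · simp [hU, hX] at hvU'
    · exact hvU'.2 ((hWmem _).2 ⟨_, rfl⟩)
    · exact (hhmem' _).2.2 hvQ
  have haM : ∀ i j, List.Disjoint (a i) (M j) := by
    intro i j v hv hvM
    obtain ⟨hvU, hvB⟩ := (hM j).2.2.2 v hvM
    rcases hamem i v hv with rfl | ⟨hi, rfl | rfl⟩
    · simp [hU, hX] at hvU
    · exact hvB (by simp [hB₀, hWmem])
    · exact hvB (by simp [hB₀, hHmem])
  have haQ : ∀ i j, List.Disjoint (a i) (Q j) := fun i j v hv hvQ =>
    haVQ i v hv ((hVQmem v).2 ⟨j, hvQ⟩)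
  have hMQ : ∀ i j, List.Disjoint (M i) (Q j) := fun i j v hv hvQ =>
    ((hM i).2.2.2 v hv).2 (mem_union_left _ ((hVQmem v).2 ⟨j, hvQ⟩))
  have haa : ∀ i j, i ≠ j → List.Disjoint (a i) (a j) := by
    have hxU : ∀ i, x i ∉ U := fun i => by simp [hU, hX]
    have hwU : ∀ i, w i ∈ U := fun i => hOU _ (hwC' i).1
    have hhU : ∀ i, h i ∈ U := fun i => hLU (hhmem' i).1
    have hwh : ∀ i j, w i ≠ h j := fun i j he => (hwC' i).2.1 (he ▸ (hhmem' j).1)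
    intro i j hij v hv hv'
    rcases hamem i v hv with rfl | ⟨hi, rfl | rfl⟩ <;>
      rcases hamem j _ hv' with h1 | ⟨hj, h1 | h1⟩
    · exact hij (hx h1)
    · exact hxU _ (h1 ▸ hwU _)
    · exact hxU _ (h1 ▸ hhU _)
    · exact hxU _ (h1 ▸ hwU _)
    · exact hij (by simpa using hw h1)
    · exact hwh _ _ h1
    · exact hxU _ (h1 ▸ hhU _)
    · exact hwh _ _ h1.symm
    · exact hij (by simpa using hh h1)
  refine ⟨fun i => a i ++ (M i ++ Q i), fun i => ?_, fun i j hij => ?_⟩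
  · exact simplePath_append (hac i) (hah i) (hal i) (han i) (hM i).1 (hM i).2.1 (hM i).2.2.1
      ((hlQ i).mono fun u v huv => huv.1) (haM i i) (haQ i i) (hMQ i i)
  · simp only [List.disjoint_append_left, List.disjoint_append_right]
    exact ⟨⟨haa i j hij, (haM j i).symm, (haQ j i).symm⟩,
      ⟨haM i j, hMd i j hij, (hMQ j i).symm⟩, haQ i j, hMQ i j, hQ.1.2 i j hij⟩

/-! ### Walks in quasi-transitive digraphs. -/

/-- Every path `x → y → z` on three vertices has adjacent ends. -/
def QuasiTrans {V : Type*} (r : V → V → Prop) : Prop :=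
  ∀ x y z, x ≠ y → y ≠ z → x ≠ z → r x y → r y z → r x z ∨ r z x

theorem QuasiTrans.flip {V : Type*} {r : V → V → Prop} (h : QuasiTrans r) :
    QuasiTrans (fun u v => r v u) := fun x y z hxy hyz hxz h1 h2 =>
  h z y x hyz.symm hxy.symm hxz.symm h2 h1

theorem QuasiTrans.adj {V : Type*} {r : V → V → Prop} (h : QuasiTrans r) (hirr : ∀ v, ¬ r v v)
    {x y z : V} (hxz : x ≠ z) (hxy : r x y) (hyz : r y z) : r x z ∨ r z x :=
  h x y z (fun e => hirr y (e ▸ hxy)) (fun e => hirr y (e ▸ hyz)) hxz hxy hyz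

/-- Restriction of a relation to a finite set of vertices. -/
def arcsIn {V : Type*} (r : V → V → Prop) (S : Finset V) (u v : V) : Prop :=
  r u v ∧ u ∈ S ∧ v ∈ S

theorem quasiTrans_arcsIn {V : Type*} {r : V → V → Prop} (h : QuasiTrans r) (S : Finset V) :
    QuasiTrans (arcsIn r S) := fun x y z hxy hyz hxz h1 h2 =>
  (h x y z hxy hyz hxz h1.1 h2.1).imp (fun h => ⟨h, h1.2.1, h2.2.2⟩) fun h => ⟨h, h2.2.2, h1.2.1⟩

theorem reflTransGen_arcsIn_flip {V : Type*} {r : V → V → Prop} {S : Finset V} {u v : V}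
    (h : ReflTransGen (arcsIn r S) u v) : ReflTransGen (arcsIn (fun u v => r v u) S) v u := by
  induction h with
  | refl => exact .refl
  | tail _ hbc ih => exact .head ⟨hbc.1, hbc.2.2, hbc.2.1⟩ ih

/-- `WalkOfLength r u n v`: there is a walk with `n` arcs from `u` to `v`. -/
def WalkOfLength {V : Type*} (r : V → V → Prop) (u : V) : ℕ → V → Prop
  | 0, v => v = u
  | n + 1, v => ∃ b, WalkOfLength r u n b ∧ r b v

theorem exists_walkOfLength {V : Type*} {r : V → V → Prop} {u v : V} (h : ReflTransGen r u v) :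
    ∃ n, WalkOfLength r u n v := by
  induction h with
  | refl => exact ⟨0, rfl⟩
  | @tail b c _ hbc ih =>
    obtain ⟨n, hn⟩ := ih
    exact ⟨n + 1, b, hn, hbc⟩

/-- In a quasi-transitive digraph a vertex at distance at least four dominates the start. -/
theorem QuasiTrans.back_or_short {V : Type*} {r : V → V → Prop} (hqt : QuasiTrans r)
    (hirr : ∀ v, ¬ r v v) (u : V) (n : ℕ) :
    ∀ d, WalkOfLength r u n d → r d u ∨ ∃ m ≤ 3, WalkOfLength r u m d := by
  induction n using Nat.strong_induction_on with
  | _ n ih =>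
  intro d hd
  by_cases hn : n ≤ 3
  · exact .inr ⟨n, hn, hd⟩
  obtain ⟨m, rfl⟩ : ∃ m, n = m + 2 := ⟨n - 2, by omega⟩
  obtain ⟨c, ⟨b, hb, hbc⟩, hcd⟩ := hd
  by_cases hbd : b = d
  · exact ih m (by omega) d (hbd ▸ hb)
  rcases hqt.adj hirr hbd hbc hcd with hbd | hdb
  · exact ih (m + 1) (by omega) d ⟨b, hb, hbd⟩
  have hfin : r b u → r d u ∨ ∃ m ≤ 3, WalkOfLength r u m d := by
    intro hbu
    by_cases hdu : d = u
    · exact .inr ⟨0, by omega, hdu⟩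
    rcases hqt.adj hirr hdu hdb hbu with h | h
    · exact .inl h
    · exact .inr ⟨1, by omega, u, rfl, h⟩
  have hzero : b = u → r d u ∨ ∃ m ≤ 3, WalkOfLength r u m d := fun h =>
    .inr ⟨2, by omega, c, ⟨b, h, hbc⟩, hcd⟩
  have hone : r u b → r d u ∨ ∃ m ≤ 3, WalkOfLength r u m d := fun h =>
    .inr ⟨3, by omega, c, ⟨b, ⟨u, rfl, h⟩, hbc⟩, hcd⟩
  by_cases hbu : b = u
  · exact hzero hbu
  -- For walks with four arcs the induction hypothesis at `c` would give no shorter walk; here `u`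
  -- and `b` are two arcs apart, hence adjacent.
  by_cases hm : m = 2
  · subst hm
    obtain ⟨p, ⟨q, rfl, hup⟩, hpb⟩ := hb
    exact (hqt.adj hirr (Ne.symm hbu) hup hpb).elim hone hfin
  · rcases ih (m + 1) (by omega) c ⟨b, hb, hbc⟩ with hcu | ⟨l, hl, hlc⟩
    · exact (hqt.adj hirr hbu hbc hcu).elim hfin hone
    · exact ih (l + 1) (by omega) d ⟨c, hlc, hcd⟩

/-- In a quasi-transitive digraph a vertex that is reachable from a nonadjacent vertex is reachable
by a path with three arcs, and this path has two backward chords. -/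
theorem QuasiTrans.exists_three_path {V : Type*} {r : V → V → Prop} (hqt : QuasiTrans r)
    (hirr : ∀ v, ¬ r v v) {v w : V} (hvw : v ≠ w) (h1 : ¬ r v w) (h2 : ¬ r w v)
    (h : ReflTransGen r v w) : ∃ p q, r v p ∧ r p q ∧ r q w ∧ r w p ∧ r q v := by
  obtain ⟨n, hn⟩ := exists_walkOfLength h
  have hno : ∀ p, r v p → ¬ r p w := fun p hp hpw =>
    (hqt.adj hirr hvw hp hpw).elim h1 h2
  rcases hqt.back_or_short hirr v n w hn with h | ⟨m, hm, hw⟩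
  · exact absurd h h2
  interval_cases m
  · exact absurd hw.symm hvw
  · obtain ⟨b, rfl, hb⟩ := hw
    exact absurd hb h1
  · obtain ⟨p, ⟨b, rfl, hp⟩, hpw⟩ := hw
    exact absurd hpw (hno p hp)
  · obtain ⟨q, ⟨p, ⟨b, rfl, hp⟩, hpq⟩, hqw⟩ := hw
    refine ⟨p, q, hp, hpq, hqw, ?_, ?_⟩
    · exact (hqt.adj hirr (fun e : p = w => h1 (e ▸ hp)) hpq hqw).resolve_left (hno p hp)
    · refine (hqt.adj hirr (fun e : b = q => h1 (e ▸ hqw)) hp hpq).resolve_left fun h => hno q h hqw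

/-- Walks into `v` can be diverted to `w` in front of `v`. -/
theorem QuasiTrans.reach_erase {V : Type*} [DecidableEq V] {r : V → V → Prop} (hqt : QuasiTrans r)
    (hirr : ∀ v, ¬ r v v) {S : Finset V} {v w p q : V} (hvw : v ≠ w) (h1 : ¬ r v w)
    (h2 : ¬ r w v) (hp : arcsIn r S v p) (hpq : arcsIn r S p q) (hqw : arcsIn r S q w)
    (hwp : r w p) {s : V} (h : ReflTransGen (arcsIn r S) s v) (hs : s ≠ v) :
    ReflTransGen (arcsIn r (S.erase v)) s w := by
  have hwS : w ∈ S.erase v := mem_erase.2 ⟨hvw.symm, hqw.2.2⟩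
  have hpv : p ≠ v := fun e => hirr v (e ▸ hp.1)
  have hpS : p ∈ S.erase v := mem_erase.2 ⟨hpv, hp.2.2⟩
  have hqS : q ∈ S.erase v := mem_erase.2 ⟨fun e => h1 (e ▸ hqw.1), hqw.2.1⟩
  have hpw : ReflTransGen (arcsIn r (S.erase v)) p w :=
    .head ⟨hpq.1, hpS, hqS⟩ (.single ⟨hqw.1, hqS, hwS⟩)
  induction h using ReflTransGen.head_induction_on with
  | refl => exact absurd rfl hs
  | @head s t hst _ ih =>
    have hsS : s ∈ S.erase v := mem_erase.2 ⟨hs, hst.2.1⟩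
    by_cases htv : t = v
    · subst htv
      by_cases hsp : s = p
      · exact hsp ▸ hpw
      by_cases hsw : s = w
      · exact hsw ▸ .refl
      have hnws : ¬ r w s := fun h =>
        (hqt.adj hirr hvw.symm h hst.1).elim h2 h1
      -- From `s → v → p`, either `s → p`, continuing through `q` to `w`, or `p → s`. In the second
      -- case `w → p → s` makes `w` and `s` adjacent, and `w → s` would make `w` and `v` adjacent
      -- through `s`.
      rcases hqt.adj hirr hsp hst.1 hp.1 with h | h
      · exact .head ⟨h, hsS, hpS⟩ hpw
      · exact .single ⟨(hqt.adj hirr (Ne.symm hsw) hwp h).resolve_left hnws, hsS, hwS⟩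
    · exact .head ⟨hst.1, hsS, mem_erase.2 ⟨htv, hst.2.2⟩⟩ (ih htv)

/-! ### Modules and the splitting of the nonadjacency graph. -/

/-- Nonadjacency (or equality) of two vertices of `S`. -/
def nonadjIn {V : Type*} (r : V → V → Prop) (S : Finset V) (u v : V) : Prop :=
  u ∈ S ∧ v ∈ S ∧ ¬ r u v ∧ ¬ r v u

theorem nonadjIn_symm {V : Type*} {r : V → V → Prop} {S : Finset V} {u v : V}
    (h : nonadjIn r S u v) : nonadjIn r S v u :=
  ⟨h.2.1, h.1, h.2.2.2, h.2.2.1⟩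

theorem reflTransGen_nonadjIn_symm {V : Type*} {r : V → V → Prop} {S : Finset V} {u v : V}
    (h : ReflTransGen (nonadjIn r S) u v) : ReflTransGen (nonadjIn r S) v u := by
  induction h with
  | refl => exact .refl
  | tail _ hbc ih => exact .head (nonadjIn_symm hbc) ih

/-- The components of the nonadjacency graph are modules. -/
theorem QuasiTrans.module {V : Type*} {r : V → V → Prop} (hqt : QuasiTrans r)
    (hirr : ∀ v, ¬ r v v) {S : Finset V} {x x' t : V} (h : ReflTransGen (nonadjIn r S) x x')
    (ht : t ∈ S) (hxt : ¬ ReflTransGen (nonadjIn r S) x t) :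
    (r x t → r x' t) ∧ (r t x → r t x') := by
  induction h with
  | refl => exact ⟨id, id⟩
  | @tail u u' hxu huu' ih =>
    by_cases hne : u = u'
    · exact hne ▸ ih
    have hadj : r u' t ∨ r t u' := by
      by_contra hno
      rw [not_or] at hno
      exact hxt ((hxu.tail huu').tail ⟨huu'.2.1, ht, hno.1, hno.2⟩)
    constructor
    · intro h
      exact hadj.resolve_right fun h' =>
        (hqt.adj hirr hne (ih.1 h) h').elim huu'.2.2.1 huu'.2.2.2
    · intro h
      exact hadj.resolve_left fun h' =>
        (hqt.adj hirr (Ne.symm hne) h' (ih.2 h)).elim huu'.2.2.2 huu'.2.2.1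

theorem adj_of_not_reflTransGen_nonadjIn {V : Type*} {r : V → V → Prop} {S : Finset V} {u v : V}
    (hu : u ∈ S) (hv : v ∈ S) (h : ¬ ReflTransGen (nonadjIn r S) u v) : r u v ∨ r v u := by
  by_contra hno
  rw [not_or] at hno
  exact h (.single ⟨hu, hv, hno.1, hno.2⟩)

/-- The nonadjacency graph of a strong quasi-transitive digraph is disconnected. -/
theorem QuasiTrans.exists_split {V : Type*} {r : V → V → Prop} (hqt : QuasiTrans r)
    (hirr : ∀ v, ¬ r v v) (S : Finset V) (hS : S.Nontrivial)
    (hstrong : ∀ a ∈ S, ∀ b ∈ S, ReflTransGen (arcsIn r S) a b) :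
    ∃ A ⊆ S, A.Nonempty ∧ (∃ b ∈ S, b ∉ A) ∧ ∀ a ∈ A, ∀ b ∈ S, b ∉ A → r a b ∨ r b a := by
  classical
  induction S using Finset.strongInduction with
  | H S ih =>
  by_cases hdom : ∃ v ∈ S, ∀ u ∈ S, u ≠ v → r v u ∨ r u v
  · obtain ⟨v, hv, hvu⟩ := hdom
    obtain ⟨b, hb, hbv⟩ := hS.exists_ne v
    exact ⟨{v}, by simpa using hv, by simp, ⟨b, hb, by simpa using hbv⟩, by
      simpa using hvu⟩
  push Not at hdom
  obtain ⟨v, hv, v₂, -, -⟩ := hS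
  obtain ⟨w, hw, hwv, hnvw, hnwv⟩ := hdom v hv
  have hirr' : ∀ u, ¬ arcsIn r S u u := fun u h => hirr u h.1
  obtain ⟨p, q, hvp, hpq, hqw, hwp, hqv⟩ := (quasiTrans_arcsIn hqt S).exists_three_path hirr' hwv.symm
    (fun h => hnvw h.1) (fun h => hnwv h.1) (hstrong v hv w hw)
  set S' := S.erase v with hS'
  have hsub : ∀ u ∈ S', u ∈ S := fun u hu => mem_of_mem_erase hu
  have hnv : ∀ u ∈ S', u ≠ v := fun u hu => ne_of_mem_erase hu
  -- Deleting `v` keeps strength: walks into `v` are diverted to `w`, and by reversing all arcs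
  -- walks out of `v` can start at `w` instead.
  have hstrong' : ∀ a ∈ S', ∀ b ∈ S', ReflTransGen (arcsIn r S') a b := by
    intro a ha b hb
    refine (hqt.reach_erase hirr hwv.symm hnvw hnwv hvp hpq hqw hwp.1
      (hstrong a (hsub a ha) v hv) (hnv a ha)).trans ?_
    have := hqt.flip.reach_erase hirr hwv.symm hnwv hnvw ⟨hqv.1, hqv.2.2, hqv.2.1⟩
      ⟨hpq.1, hpq.2.2, hpq.2.1⟩ ⟨hwp.1, hwp.2.2, hwp.2.1⟩ hqw.1
      (reflTransGen_arcsIn_flip (hstrong v hv b (hsub b hb))) (hnv b hb)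
    exact reflTransGen_arcsIn_flip this
  have hwS' : w ∈ S' := mem_erase.2 ⟨hwv, hw⟩
  have hpS' : p ∈ S' := mem_erase.2 ⟨fun e => hirr v (e ▸ hvp.1), hvp.2.2⟩
  have hpw : p ≠ w := fun e => hirr w (e ▸ hwp.1)
  obtain ⟨A, hAS, ⟨a₀, ha₀⟩, ⟨b₀, hb₀S, hb₀⟩, hA⟩ := ih S' (erase_ssubset hv)
    ⟨p, hpS', w, hwS', hpw⟩ hstrong'
  let c := ReflTransGen (nonadjIn r S')
  have hcA : ∀ u u', c u u' → (u ∈ A ↔ u' ∈ A) := by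
    intro u u' h
    induction h with
    | refl => rfl
    | @tail u₁ u₂ _ h ih =>
      rw [ih]
      constructor
      · intro h1
        by_contra h2
        exact (hA u₁ h1 u₂ h.2.1 h2).elim h.2.2.1 h.2.2.2
      · intro h1
        by_contra h2
        exact (hA u₂ h1 u₁ h.1 h2).elim h.2.2.2 h.2.2.1
  have hother : ∀ u, ∃ b ∈ S', ¬ c u b := by
    intro u
    by_cases hu : u ∈ A
    · exact ⟨b₀, hb₀S, fun h => hb₀ ((hcA _ _ h).1 hu)⟩
    · exact ⟨a₀, hAS ha₀, fun h => hu ((hcA _ _ h).2 ha₀)⟩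
  have hcS : ∀ u u', c u u' → u ∈ S' → u' ∈ S' := fun u u' h hu => by
    rcases h.cases_tail with rfl | ⟨b, -, hb⟩
    exacts [hu, hb.2.1]
  -- A component of `S'` entirely adjacent to `v` remains split off when `v` returns. Otherwise
  -- every component contains a non-neighbour of `v`.
  by_cases hfull : ∃ z ∈ S', ∀ z', c z z' → r z' v ∨ r v z'
  · obtain ⟨z, hz, hzv⟩ := hfull
    obtain ⟨b, hb, hzb⟩ := hother z
    refine ⟨S'.filter (c z), (filter_subset _ _).trans (erase_subset _ _),
      ⟨z, mem_filter.2 ⟨hz, .refl⟩⟩, ⟨b, hsub b hb, fun h => hzb (mem_filter.1 h).2⟩, ?_⟩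
    intro a ha b hb hab
    rw [mem_filter] at ha
    by_cases hbv : b = v
    · exact hbv ▸ hzv a ha.2
    · have hbS : b ∈ S' := mem_erase.2 ⟨hbv, hb⟩
      exact adj_of_not_reflTransGen_nonadjIn ha.1 hbS fun h =>
        hab (mem_filter.2 ⟨hbS, ha.2.trans h⟩)
  push Not at hfull
  exfalso
  obtain ⟨t, htS', htv⟩ : ∃ t ∈ S', r t v := by
    rcases (hstrong w hw v hv).cases_tail with h | ⟨t, -, ht⟩
    · exact absurd h.symm hwv
    · exact ⟨t, mem_erase.2 ⟨fun e => hirr v (e ▸ ht.1), ht.2.1⟩, ht.1⟩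
  obtain ⟨b, hb, htb⟩ := hother t
  -- An arc enters the component of `t` from another component. The latter has a non-neighbour `x'`
  -- of `v`, and the module property gives `x' → t → v`, forcing adjacency.
  obtain ⟨x, y, hxy, hx, hy⟩ := (hstrong' b hb t htS').exists_step (P := c t) htb .refl
  have hxt : r x t :=
    (hqt.module hirr (reflTransGen_nonadjIn_symm hy) hxy.2.1
      fun h => hx (hy.trans h)).2 hxy.1
  obtain ⟨x', hxx', hx'v, hvx'⟩ := hfull x hxy.2.1
  have hx't : r x' t := (hqt.module hirr hxx' htS' fun h =>
    hx (reflTransGen_nonadjIn_symm h)).1 hxt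
  exact (hqt.adj hirr (hnv x' (hcS _ _ hxx' hxy.2.1)) hx't htv).elim hx'v hvx'

/-! ### Completing the modules to a semicomplete digraph. -/

/-- Two vertices lie in the same component of the nonadjacency graph. -/
def SameModule {V : Type*} [Fintype V] (r : V → V → Prop) : V → V → Prop :=
  ReflTransGen (nonadjIn r univ)

section Module

variable {V : Type*} [Fintype V] {r : V → V → Prop}

theorem SameModule.symm {u v : V} (h : SameModule r u v) : SameModule r v u :=
  reflTransGen_nonadjIn_symm h

theorem SameModule.trans {u v w : V} (h : SameModule r u v) (h' : SameModule r v w) :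
    SameModule r u w :=
  ReflTransGen.trans h h'

theorem QuasiTrans.rel_left (hqt : QuasiTrans r) (hirr : ∀ v, ¬ r v v) {x x' t : V}
    (h : SameModule r x x') (hxt : ¬ SameModule r x t) (hr : r x t) : r x' t :=
  (hqt.module hirr h (mem_univ t) hxt).1 hr

theorem QuasiTrans.rel_right (hqt : QuasiTrans r) (hirr : ∀ v, ¬ r v v) {x x' t : V}
    (h : SameModule r x x') (hxt : ¬ SameModule r x t) (hr : r t x) : r t x' :=
  (hqt.module hirr h (mem_univ t) hxt).2 hr

theorem adj_of_not_sameModule {u v : V} (h : ¬ SameModule r u v) : r u v ∨ r v u :=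
  adj_of_not_reflTransGen_nonadjIn (mem_univ u) (mem_univ v) h

/-- There are no opposite arcs between a nontrivial module and another vertex. -/
theorem QuasiTrans.not_rel_of_rel (hqt : QuasiTrans r) (hirr : ∀ v, ¬ r v v) {u u' t : V}
    (h : SameModule r u u') (hne : u ≠ u') (hut : ¬ SameModule r u t) (h1 : r u t) : ¬ r t u := by
  intro h2
  -- Leaving `u` inside its module yields a non-neighbour `y ≠ u`; opposite arcs with `t` would give
  -- `u → t → y`.
  obtain ⟨x, y, hxy, hx, hy⟩ := ReflTransGen.exists_step (P := (· ≠ u)) h (by simp) hne.symm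
  obtain rfl : x = u := by simpa using hx
  have hxy' : SameModule r x y := .single hxy
  exact (hqt.adj hirr (Ne.symm hy) h1 (hqt.rel_right hirr hxy' hut h2)).elim hxy.2.2.1 hxy.2.2.2

theorem QuasiTrans.exists_not_sameModule [Nontrivial V] (hqt : QuasiTrans r)
    (hirr : ∀ v, ¬ r v v) (hstrong : ∀ a b, ReflTransGen r a b) (u : V) :
    ∃ t, ¬ SameModule r u t := by
  obtain ⟨A, -, ⟨a, ha⟩, ⟨b, -, hb⟩, hA⟩ := hqt.exists_split hirr univ
    (by simpa [Finset.Nontrivial] using Set.nontrivial_univ (α := V)) fun a _ b _ =>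
      ReflTransGen.mono (fun u v h => ⟨h, mem_univ u, mem_univ v⟩) _ _ (hstrong a b)
  have hsplit : ∀ u v, SameModule r u v → u ∈ A → v ∈ A := by
    intro u v h hu
    by_contra hv
    obtain ⟨x, y, hxy, hx, hy⟩ := ReflTransGen.exists_step (P := (· ∉ A)) h (by simpa using hu) hv
    exact (hA x (by simpa using hx) y (mem_univ y) hy).elim hxy.2.2.1 hxy.2.2.2
  by_cases hu : u ∈ A
  · exact ⟨b, fun h => hb (hsplit _ _ h hu)⟩
  · exact ⟨a, fun h => hu (hsplit _ _ h.symm ha)⟩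

/-- Between modules the arcs are those of `r`; inside a module all pairs become adjacent, and the
vertices of `Y` receive no arcs from the other vertices. -/
def completion (r : V → V → Prop) (Y : Finset V) (u v : V) : Prop :=
  (¬ SameModule r u v ∧ r u v) ∨
    (SameModule r u v ∧ u ≠ v ∧ (u ∈ Y ∨ (v ∉ Y ∧ (r u v ∨ ¬ r v u))))

theorem completion_irrefl (hirr : ∀ v, ¬ r v v) (Y : Finset V) (v : V) : ¬ completion r Y v v := by
  rintro (h | h)
  exacts [hirr v h.2, h.2.1 rfl]

theorem completion_semicomplete (Y : Finset V) {u v : V} (h : u ≠ v) :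
    completion r Y u v ∨ completion r Y v u := by
  by_cases hc : SameModule r u v
  · have hc' := hc.symm
    have hne := h.symm
    unfold completion
    tauto
  · have hc' : ¬ SameModule r v u := fun h => hc h.symm
    exact (adj_of_not_sameModule hc).imp (fun h => .inl ⟨hc, h⟩) fun h => .inl ⟨hc', h⟩

/-- Only arcs into `Y` can be lost, so the out-degree counted off the ends does not drop. -/
theorem completion_of_rel (hirr : ∀ v, ¬ r v v) {Y : Finset V} {u v : V} (h : r u v)
    (hv : v ∉ Y) : completion r Y u v := by
  by_cases hc : SameModule r u v
  · exact .inr ⟨hc, fun e => hirr v (e ▸ h), .inr ⟨hv, .inl h⟩⟩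
  · exact .inl ⟨hc, h⟩

/-- A walk ending in `v` can be replaced by one whose arcs all join different modules, unless it
starts in the module of `v`. -/
theorem QuasiTrans.reach_between (hqt : QuasiTrans r) (hirr : ∀ v, ¬ r v v) {S : Finset V}
    {u v : V} (hv : v ∉ S) (h : ReflTransGen (fun a b => r a b ∧ a ∉ S ∧ b ∉ S) u v) :
    SameModule r u v ∨
      ReflTransGen (fun a b => (¬ SameModule r a b ∧ r a b) ∧ a ∉ S ∧ b ∉ S) u v := by
  induction h using ReflTransGen.head_induction_on with
  | refl => exact .inl .refl
  | @head a b hab _ ih =>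
    by_cases hav : SameModule r a v
    · exact .inl hav
    by_cases hc : SameModule r a b
    · rcases ih with ih | ih
      · exact absurd (hc.trans ih) hav
      rcases ih.cases_head with rfl | ⟨t, ht, htv⟩
      · exact absurd hc hav
      · exact .inr (.head ⟨⟨fun h => ht.1.1 (hc.symm.trans h),
          hqt.rel_left hirr hc.symm ht.1.1 ht.1.2⟩, hab.2.1, ht.2.2⟩ htv)
    · rcases ih with ih | ih
      · exact .inr (.single ⟨⟨hav, hqt.rel_right hirr ih (fun h => hc h.symm) hab.1⟩,
          hab.2.1, hv⟩)
      · exact .inr (.head ⟨⟨hc, hab.1⟩, hab.2⟩ ih)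

/-- The completion is as strongly connected as the quasi-transitive digraph. -/
theorem QuasiTrans.completion_reach [Nontrivial V] (hqt : QuasiTrans r) (hirr : ∀ v, ¬ r v v)
    (Y : Finset V) {m : ℕ} (hm : 1 ≤ m)
    (hstrong : ∀ S : Finset V, S.card < m → ∀ a b, a ∉ S → b ∉ S →
      ReflTransGen (fun u v => r u v ∧ u ∉ S ∧ v ∉ S) a b)
    (S : Finset V) (hS : S.card < m) (a b : V) (ha : a ∉ S) (hb : b ∉ S) :
    ReflTransGen (fun u v => completion r Y u v ∧ u ∉ S ∧ v ∉ S) a b := by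
  classical
  have hmono : ∀ u, ReflTransGen (fun a b => (¬ SameModule r a b ∧ r a b) ∧ a ∉ S ∧ b ∉ S) u b →
      ReflTransGen (fun u v => completion r Y u v ∧ u ∉ S ∧ v ∉ S) u b := fun u =>
    ReflTransGen.mono (fun u v h => ⟨.inl h.1, h.2⟩) _ _
  by_cases hab : a = b
  · exact hab ▸ .refl
  by_cases hc : SameModule r a b
  swap
  · exact hmono a ((hqt.reach_between hirr hb (hstrong S hS a b ha hb)).resolve_left hc)
  have hall : ∀ u v, ReflTransGen r u v := fun u v =>
    ReflTransGen.mono (fun _ _ h => h.1) _ _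
      (hstrong ∅ (by rw [card_empty]; omega) u v (by simp) (by simp))
  -- To join two vertices of one module, leave the module first. If all exits `N` from `a` were in
  -- `S`, deleting `N` would trap `a` in its module, unless `N` contains every vertex outside. In
  -- that case no arc enters the module, as it is nontrivial and so has no opposite arcs with
  -- outside vertices.
  obtain ⟨z, hzS, hz, haz⟩ : ∃ z, z ∉ S ∧ ¬ SameModule r a z ∧ r a z := by
    by_contra! hno
    let N := S.filter fun z => ¬ SameModule r a z ∧ r a z
    have hN : ∀ z, ¬ SameModule r a z → r a z → z ∈ N := fun z h1 h2 =>
      mem_filter.2 ⟨by_contra fun h => hno z h h1 h2, h1, h2⟩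
    have haN : a ∉ N := fun h => (mem_filter.1 h).2.1 .refl
    by_cases ht : ∃ t, ¬ SameModule r a t ∧ t ∉ N
    · obtain ⟨t, hat, htN⟩ := ht
      obtain ⟨x, y, hxy, hx, hy⟩ := (hstrong N ((card_filter_le _ _).trans_lt hS) a t haN
        htN).exists_step (P := fun v => ¬ SameModule r a v) (fun h => h .refl) hat
      rw [not_not] at hx
      exact hxy.2.2 (hN y hy (hqt.rel_left hirr hx.symm (fun h => hy (hx.trans h)) hxy.1))
    · push Not at ht
      obtain ⟨t, hat⟩ := hqt.exists_not_sameModule hirr hall a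
      obtain ⟨x, y, hxy, hx, hy⟩ := (hall t a).exists_step (P := SameModule r a) hat .refl
      exact hqt.not_rel_of_rel hirr hc hab hx (mem_filter.1 (ht x hx)).2.2
        (hqt.rel_right hirr hy.symm (fun h => hx (hy.trans h)) hxy)
  exact .head ⟨.inl ⟨hz, haz⟩, ha, hzS⟩
    (hmono z ((hqt.reach_between hirr hb (hstrong S hS z b hzS hb)).resolve_left
      fun h => hz (hc.trans h.symm)))

/-- A path of the completion ending in its only vertex of `Y` yields a path of the original digraph
on a subset of its vertices. -/
theorem QuasiTrans.exists_simplePath_of_completion (hqt : QuasiTrans r) (hirr : ∀ v, ¬ r v v)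
    {Y : Finset V} {a b : V} {p : List V} (hp : SimplePath (completion r Y) a b p) (hb : b ∈ Y)
    (hpY : ∀ v ∈ p, v ∈ Y → v = b) : ∃ q, SimplePath r a b q ∧ ∀ v ∈ q, v ∈ p := by
  have hbp : b ∈ p := List.mem_of_getLast? hp.2.1
  have hwalk : ReflTransGen (fun u v => completion r Y u v ∧ u ∈ p ∧ v ∈ p) a b :=
    SimplePath.reflTransGen (p := p) ⟨hp.1, hp.2.1, hp.2.2.1,
      hp.2.2.2.imp_of_mem_imp fun u v hu hv h => ⟨h, hu, hv⟩⟩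
  have hbetween : ReflTransGen (fun u v => (¬ SameModule r u v ∧ r u v) ∧ u ∈ p) a b := by
    clear hp
    induction hwalk using ReflTransGen.head_induction_on with
    | refl => exact .refl
    | @head u v huv _ ih =>
      by_cases hub : u = b
      · exact hub ▸ .refl
      rcases huv.1 with h | ⟨hc, -, hY⟩
      · exact .head ⟨h, huv.2.1⟩ ih
      have huY : u ∉ Y := fun h => hub (hpY u huv.2.1 h)
      -- An arc inside a module is skipped, since its tail also dominates the next vertex `t`. It
      -- cannot be the last arc, because it would enter `b ∈ Y` from outside `Y`.
      rcases ih.cases_head with rfl | ⟨t, ht, htb⟩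
      · exact absurd hb (hY.resolve_left huY).1
      · exact .head ⟨⟨fun h => ht.1.1 (hc.symm.trans h),
          hqt.rel_left hirr hc.symm ht.1.1 ht.1.2⟩, huv.2.1⟩ htb
  obtain ⟨q, hq⟩ := exists_simplePath_of_reflTransGen hbetween
  exact ⟨q, hq.mono fun u v h => h.1.2, hq.forall_mem (fun u v h => h.2) hbp⟩

end Module

/-! ### The main theorem. -/

theorem corollary1p7 {V : Type*} [Finite V] (D : Digraph V) (hD : D.IsLoopless)
    (k : ℕ) (hk : 1 ≤ k) (hqt : D.IsQuasiTransitive) (hstrong : D.IsStrong (3 * k))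
    (hdeg : 23 * k ≤ D.minOutDegree) :
    D.IsLinked k := by
  classical
  have := Fintype.ofFinite V
  obtain ⟨hcard, hconn⟩ := hstrong
  have : Nontrivial V := Finite.one_lt_card_iff_nontrivial.1 (by omega)
  refine ⟨by omega, fun x y hx hy hxy => ?_⟩
  have hqt' : QuasiTrans D.Adj := hqt
  have hreach : ∀ S : Finset V, S.card < 3 * k → ∀ a b, a ∉ S → b ∉ S →
      ReflTransGen (fun u v => D.Adj u v ∧ u ∉ S ∧ v ∉ S) a b := by
    intro S hS a b ha hb
    by_cases hab : a = b
    · exact hab ▸ .refl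
    obtain ⟨p, ⟨hh, hl, hn, hc⟩, hpS⟩ := hconn S hS a b ha hb hab
    exact SimplePath.reflTransGen (p := p)
      ⟨hh, hl, hn, hc.imp_of_mem_imp fun u v hu hv h => ⟨h, hpS u hu, hpS v hv⟩⟩
  obtain ⟨P, hP, hPd⟩ := exists_linking_of_semicomplete (completion D.Adj (univ.image y))
    (completion_irrefl hD _) (fun u v h => completion_semicomplete _ h) k hk x y hx hy hxy
    (hqt'.completion_reach hD _ (by omega) hreach) (by
      intro v
      have h1 : 23 * k ≤ {u | D.Adj v u}.ncard := hdeg.trans (ciInf_le' _ v)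
      -- Discarding the at most `2k` prescribed vertices leaves `21k` of the `23k` out-neighbours.
      have h2 : {u | D.Adj v u}.ncard ≤ {u | completion D.Adj (univ.image y) v u ∧
          (∀ i, u ≠ x i) ∧ ∀ i, u ≠ y i}.ncard + (Set.range x ∪ Set.range y).ncard := by
        refine (Set.ncard_le_ncard ?_).trans (Set.ncard_union_le _ _)
        intro u hu
        by_cases hmem : u ∈ Set.range x ∪ Set.range y
        · exact .inr hmem
        · refine .inl ?_
          simp only [Set.mem_union, Set.mem_range, not_or, not_exists] at hmem
          exact ⟨completion_of_rel hD hu (by simpa using hmem.2),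
            fun i h => hmem.1 i h.symm, fun i h => hmem.2 i h.symm⟩
      have hr : ∀ z : Fin k → V, (Set.range z).ncard ≤ k := fun z => by
        rw [← Set.image_univ]
        exact (Set.ncard_image_le Set.finite_univ).trans (by simp)
      have h3 := Set.ncard_union_le (Set.range x) (Set.range y)
      have := hr x
      have := hr y
      omega)
  -- By disjointness `P i` contains no end other than `y i`, so it pulls back within its own vertex
  -- set.
  have hq : ∀ i, ∃ q, SimplePath D.Adj (x i) (y i) q ∧ ∀ v ∈ q, v ∈ P i := fun i => by
    refine hqt'.exists_simplePath_of_completion hD (hP i) (mem_image_of_mem y (mem_univ i)) ?_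
    intro v hv hvY
    obtain ⟨j, -, rfl⟩ := mem_image.1 hvY
    by_contra hne
    exact hPd i j (fun e => hne (e ▸ rfl)) hv (List.mem_of_getLast? (hP j).2.1)
  choose Q hQ hQP using hq
  exact ⟨Q, hQ, fun i j hij v hvi hvj => hPd i j hij (hQP i v hvi) (hQP j v hvj)⟩
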